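/- Throughout, a graph is a finite multigraph $G=(V,E)$ without loops (parallel edges are allowed). Let $G$ be connected, fix an orientation of its edges, let $\partial:\mathbb Z^E\to\mathbb Z^V$, $\partial(e)=\mathrm{head}(e)-\mathrm{tail}(e)$, be the boundary map and $L=\partial\,\partial^{\top}$ the Laplacian. Put $\mathrm{Div}(G)=\mathbb Z^V$, $\mathrm{Prin}(G)=\mathrm{im}(L)$, $\mathrm{Jac}(G)=\mathrm{Div}(G)/\mathrm{Prin}(G)$, and $g=|E|-|V|+1$. The degree of a divisor $D\in\mathrm{Div}(G)$ is $\deg D=\sum_{v\in V} D(v)$, the canonical divisor $K$ is given by $K(v)=\deg(v)-2$ (where $\deg(v)$ is the number of edges at $v$), and the rank is $$r(D)=\max\{k\in\mathbb Z_{\ge -1}:\ \text{for every divisor } E'\ge 0 \text{ with } \deg E'=k \text{ there is } \varphi\in\mathrm{Prin}(G) \text{ with } D-\varphi-E'\ge 0\}.$$ Let $C_\bullet(G)=[\mathbb Z^E\xrightarrow{\partial}\mathbb Z^V]$ with Euler characteristic $\chi(C_\bullet(G))=\mathrm{rank}\,H_0-\mathrm{rank}\,H_1$, let $D_{\mathrm{div}}(G)=[\mathrm{Prin}(G)\hookrightarrow\mathrm{Div}(G)]$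 be the divisor complex, with $\mathrm{Prin}(G)$ in cohomological degree $-1$ and $\mathrm{Div}(G)$ in degree $0$, and let $\mathbf D=\mathbf R\mathrm{Hom}_{\mathbb Z}(-,\mathbb Z)$, so that $H^k\mathbf D(X)=\mathrm{Hom}_{D(\mathbb Z)}(X,\mathbb Z[k])$; write $\chi(\mathbf D(X))=\sum_k(-1)^k\,\mathrm{rank}_{\mathbb Z}H^k\mathbf D(X)$. **Theorem (Baker–Norine Riemann–Roch via derived duality).** For every divisor $D$ on $G$, the maxima defining $r(D)$ and $r(K-D)$ exist, and $$r(D)-r(K-D)=\deg D+1-g .$$ Equivalently, the rank defect is governed by Euler characteristics: $$r(D)-r(K-D)=\deg D+\chi(C_\bullet(G))=\chi\bigl(\mathbf D(D_{\mathrm{div}}(G))\bigr)+\deg D-g .$$ Moreover, the groups $H^k\mathbf D(D_{\mathrm{div}}(G))$ are finitely generated and vanish for $k\notin\{0,1\}$, one has $\chi(\mathbf D(D_{\mathrm{div}}(G)))=1$, and $H^1\mathbf D(D_{\mathrm{div}}(G))\cong\mathrm{tors}\,\mathrm{Jac}(G)$. -/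

import Mathlib

open CategoryTheory
open scoped Graph

universe w u v

namespace GraphRR

/-! A finite multigraph is Mathlib's `Graph α β` (parallel edges are allowed), with vertex set
`V(G)` and edge set `E(G)`. Loops are excluded by `G.Loopless`, and connectedness is that of
`G.toSimpleGraph`, which joins two distinct vertices exactly when some edge of `G` does. -/

/-- An orientation of the edges of `G`: each edge `e` runs from `tail e` to `head e`. -/
structure Orientation {α : Type u} {β : Type v} (G : Graph α β) where
  tail : E(G) → V(G)
  head : E(G) → V(G)
  isLink : ∀ e : E(G), G.IsLink e (tail e) (head e)

/-- Divisors: `Div(G) = C₀(G) = ℤ^V`. -/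
abbrev Divisor {α : Type u} {β : Type v} (G : Graph α β) : Type u := V(G) → ℤ

section Basic

variable {α : Type u} {β : Type v} {G : Graph α β} [Fintype V(G)] [Fintype E(G)]

/-- The degree of a divisor. -/
def deg (D : Divisor G) : ℤ := ∑ x, D x

/-- The genus `g = |E| - |V| + 1`. -/
def genus (G : Graph α β) [Fintype V(G)] [Fintype E(G)] : ℤ :=
  (Fintype.card E(G) : ℤ) - Fintype.card V(G) + 1

/-- The canonical divisor `K(x) = deg(x) - 2`, where `deg(x)` is the number of edges at `x`
(in a loopless graph). -/
noncomputable def canonicalDivisor (G : Graph α β) : Divisor G :=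
  fun x => ((G.incidenceSet (x : α)).ncard : ℤ) - 2

open Classical in
/-- The boundary map `∂ : C₁(G) = ℤ^E → C₀(G) = ℤ^V`, `∂ e = head e - tail e`. -/
noncomputable def boundary (o : Orientation G) : (E(G) → ℤ) →ₗ[ℤ] (V(G) → ℤ) where
  toFun c := fun x =>
    ∑ e, c e * ((if o.head e = x then 1 else 0) - (if o.tail e = x then 1 else 0))
  map_add' c d := by
    ext x
    simp only [Pi.add_apply, add_mul, Finset.sum_add_distrib]
  map_smul' a c := by
    ext x
    simp only [Pi.smul_apply, smul_eq_mul, Finset.mul_sum, mul_assoc, RingHom.id_apply]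

/-- The transpose `∂ᵀ : ℤ^V → ℤ^E`, `(∂ᵀ f)(e) = f(head e) - f(tail e)`. -/
def coboundary (o : Orientation G) : (V(G) → ℤ) →ₗ[ℤ] (E(G) → ℤ) where
  toFun f := fun e => f (o.head e) - f (o.tail e)
  map_add' f h := by
    ext e
    simp only [Pi.add_apply]
    ring
  map_smul' a f := by
    ext e
    simp only [Pi.smul_apply, smul_eq_mul, RingHom.id_apply]
    ring

/-- The Laplacian `L = ∂ ∂ᵀ`. -/
noncomputable def laplacian (o : Orientation G) : Divisor G →ₗ[ℤ] Divisor G :=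
  boundary o ∘ₗ coboundary o

/-- The principal divisors `Prin(G) = im L`. -/
noncomputable def prin (o : Orientation G) : Submodule ℤ (Divisor G) :=
  LinearMap.range (laplacian o)

/-- The Jacobian `Jac(G) = Div(G) / Prin(G)`. -/
abbrev Jac (o : Orientation G) : Type u := Divisor G ⧸ prin o

/-- The integers `k ≥ -1` such that, for every effective divisor `E` of degree `k`, some divisor
linearly equivalent to `D - E` is effective. -/
def rankSet (o : Orientation G) (D : Divisor G) : Set ℤ :=
  {k | -1 ≤ k ∧ ∀ E : Divisor G, 0 ≤ E → deg E = k → ∃ φ ∈ prin o, 0 ≤ D - φ - E}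

/-- The Baker–Norine rank `r(D)`, the maximum of `rankSet o D`. -/
noncomputable def rank (o : Orientation G) (D : Divisor G) : ℤ := sSup (rankSet o D)

/-- The Euler characteristic `rank H₀ - rank H₁` of the two-term chain complex
`C₁(G) → C₀(G)` given by `∂`. -/
noncomputable def masterEulerChar (o : Orientation G) : ℤ :=
  (Module.finrank ℤ ((V(G) → ℤ) ⧸ LinearMap.range (boundary o)) : ℤ)
    - Module.finrank ℤ (LinearMap.ker (boundary o))

/-- The divisor complex `Prin(G) ↪ Div(G)`, with `Prin(G)` in degree `-1` and `Div(G)` in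
degree `0`, as the mapping cone of the inclusion of complexes concentrated in degree `0`. -/
noncomputable def divisorComplex (o : Orientation G) : CochainComplex (ModuleCat.{u} ℤ) ℤ :=
  CochainComplex.mappingCone
    ((CochainComplex.singleFunctor (ModuleCat.{u} ℤ) 0).map (ModuleCat.ofHom (prin o).subtype))

end Basic

/-- The cohomology `H^k` of the derived dual `RHom(X, ℤ)` of a complex `X` of abelian groups:
the group of morphisms `X ⟶ ℤ[k]` in the derived category. -/
noncomputable def derivedDualCohomology [HasDerivedCategory.{w} (ModuleCat.{u} ℤ)]
    (X : CochainComplex (ModuleCat.{u} ℤ) ℤ) : GradedObject ℤ (ModuleCat.{w} ℤ) :=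
  fun k => ModuleCat.of ℤ
    (ShiftedHom (DerivedCategory.Q.obj X)
      ((DerivedCategory.singleFunctor (ModuleCat.{u} ℤ) 0).obj (ModuleCat.of ℤ (ULift.{u} ℤ))) k)

/-- The Euler characteristic `∑ (-1)^k rank H^k` of the derived dual of `X`. -/
noncomputable def derivedDualEulerChar [HasDerivedCategory.{w} (ModuleCat.{u} ℤ)]
    (X : CochainComplex (ModuleCat.{u} ℤ) ℤ) : ℤ :=
  GradedObject.eulerChar (ComplexShape.up ℤ) (derivedDualCohomology X)

end GraphRR

/-! The combinatorial half is the Baker–Norine argument. An injective labelling p of the vertices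
directs each edge to its larger end and gives ν_p = indegree − 1, a divisor of degree g − 1. No ν_p
is equivalent to an effective divisor (`acyclicDivisor_not_effective`), and any D with this property
is dominated, up to equivalence, by some ν_p (`exists_acyclicDivisor_of_not_effective`); there p
comes from burning a q-reduced representative. Reversing the labels exchanges ν_p and K − ν_p.

Choose E ≥ 0 of degree r(D) + 1 with D − E not equivalent to an effective divisor, and p with F ~
ν_p − (D − E), F ≥ 0. If K − D − F were equivalent to an effective divisor, so would be K − D − F +
E ~ ν_{−p}, which is impossible. Hence r(K − D) < deg F = r(D) + g − deg D, one inequality; the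
other is the same with K − D in place of D.

For the derived dual, Prin and Div are free, so the exact sequence of the cone leaves only H⁰ and
H¹: the kernel and cokernel of restriction Hom(Div, ℤ) → Hom(Prin, ℤ). As L is symmetric with kernel
the constants, the kernel is ℤ·deg and the cokernel is the degree-zero part of Jac, which is its
torsion. Thus χ = 1 − 0. -/

namespace GraphRR

section Combinatorics

set_option linter.unusedSectionVars false

variable {α : Type u} {β : Type v} {G : Graph α β} [Fintype V(G)] [Fintype E(G)]

/-! ### The Laplacian, its kernel, and the rank of the Jacobian -/

open Classical in
lemma laplacian_apply (o : Orientation G) (f : Divisor G) (x : V(G)) :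
    laplacian o f x = ∑ e, (f (o.head e) - f (o.tail e)) *
      ((if o.head e = x then 1 else 0) - (if o.tail e = x then 1 else 0)) := by
  simp [laplacian, boundary, coboundary]

lemma Orientation.head_ne_tail [G.Loopless] (o : Orientation G) (e : E(G)) :
    o.head e ≠ o.tail e := by
  intro h
  exact (o.isLink e).ne (congrArg Subtype.val h.symm)

/-- Summation by parts: ⟨f, ∂∂ᵀh⟩ = ⟨∂ᵀf, ∂ᵀh⟩. Symmetry, degree zero of the image, and the
description of the kernel all follow from it. -/
lemma sum_mul_laplacian (o : Orientation G) (f h : Divisor G) :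
    ∑ x, f x * laplacian o h x =
      ∑ e, (f (o.head e) - f (o.tail e)) * (h (o.head e) - h (o.tail e)) := by
  classical
  simp_rw [laplacian_apply, Finset.mul_sum]
  rw [Finset.sum_comm]
  refine Finset.sum_congr rfl fun e _ => ?_
  have : ∀ x, f x * ((h (o.head e) - h (o.tail e)) *
      ((if o.head e = x then 1 else 0) - (if o.tail e = x then 1 else 0))) =
      (if o.head e = x then f x * (h (o.head e) - h (o.tail e)) else 0) -
      (if o.tail e = x then f x * (h (o.head e) - h (o.tail e)) else 0) := by
    intro x; split_ifs <;> ring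
  simp_rw [this, Finset.sum_sub_distrib, Finset.sum_ite_eq, Finset.mem_univ, if_true]
  ring

/-- The Laplacian is symmetric. -/
lemma sum_mul_laplacian_comm (o : Orientation G) (f h : Divisor G) :
    ∑ x, f x * laplacian o h x = ∑ x, h x * laplacian o f x := by
  simp_rw [sum_mul_laplacian, mul_comm]

lemma deg_laplacian (o : Orientation G) (f : Divisor G) : deg (laplacian o f) = 0 := by
  have := sum_mul_laplacian o 1 f
  simpa [deg] using this

lemma deg_eq_zero_of_mem_prin {o : Orientation G} {φ : Divisor G} (h : φ ∈ prin o) :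
    deg φ = 0 := by
  obtain ⟨f, rfl⟩ := h
  exact deg_laplacian o f

lemma deg_add (D E : Divisor G) : deg (D + E) = deg D + deg E := by
  simp [deg, Finset.sum_add_distrib]

lemma deg_sub (D E : Divisor G) : deg (D - E) = deg D - deg E := by
  simp [deg]

lemma deg_smul (c : ℤ) (D : Divisor G) : deg (c • D) = c * deg D := by
  simp [deg, Finset.mul_sum]

lemma deg_nonneg {D : Divisor G} (h : 0 ≤ D) : 0 ≤ deg D :=
  Finset.sum_nonneg fun x _ => h x

open Classical in
lemma deg_single (x : V(G)) (c : ℤ) : deg (Pi.single x c : Divisor G) = c := by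
  simp [deg]

/-- On a connected graph, a set of vertices that is closed under adjacency is everything. -/
lemma forall_of_forall_edge [G.Loopless] (hG : G.toSimpleGraph.Connected) (o : Orientation G)
    (P : V(G) → Prop) (h : ∀ e, P (o.head e) ↔ P (o.tail e)) {q : V(G)} (hq : P q) (x : V(G)) :
    P x := by
  obtain ⟨W⟩ := hG.preconnected q x
  induction W with
  | nil => exact hq
  | cons hadj _ ih =>
    apply ih
    rw [Graph.toSimpleGraph_adj_iff] at hadj
    obtain ⟨e, he⟩ := hadj
    have he' := o.isLink ⟨e, he.edge_mem⟩
    have hP := h ⟨e, he.edge_mem⟩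
    rcases he.eq_and_eq_or_eq_and_eq he' with ⟨h1, h2⟩ | ⟨h1, h2⟩
    · rw [← Subtype.ext h1, ← Subtype.ext h2] at hP
      exact hP.2 hq
    · rw [← Subtype.ext h1, ← Subtype.ext h2] at hP
      exact hP.1 hq

/-- If Lf = 0 then ⟨f, Lf⟩, the sum of the squared differences along edges, vanishes; so f agrees at
the ends of every edge. -/
lemma eq_of_laplacian_eq_zero [G.Loopless] (hG : G.toSimpleGraph.Connected) (o : Orientation G)
    {f : Divisor G} (hf : laplacian o f = 0) (x y : V(G)) : f x = f y := by
  have h := sum_mul_laplacian o f f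
  simp only [hf, Pi.zero_apply, mul_zero, Finset.sum_const_zero] at h
  have h0 := (Finset.sum_eq_zero_iff_of_nonneg (fun e _ => mul_self_nonneg _)).1 h.symm
  refine forall_of_forall_edge hG o (fun x => f x = f y) (fun e => ?_) rfl x
  have := mul_self_eq_zero.1 (h0 e (Finset.mem_univ e))
  rw [sub_eq_zero.1 this]

lemma laplacian_const (o : Orientation G) (c : ℤ) : laplacian o (fun _ => c) = 0 := by
  ext x
  simp [laplacian_apply]

/-- On a connected graph, the kernel of the Laplacian consists of the constants. -/
noncomputable def kerLaplacianEquiv [G.Loopless] (hG : G.toSimpleGraph.Connected)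
    (o : Orientation G) (q : V(G)) : LinearMap.ker (laplacian o) ≃ₗ[ℤ] ℤ :=
  LinearEquiv.ofBijective ((LinearMap.proj q).comp (LinearMap.ker (laplacian o)).subtype)
    ⟨fun f h hfh => Subtype.ext (funext fun x =>
        (eq_of_laplacian_eq_zero hG o f.2 x q).trans
          (Eq.trans hfh (eq_of_laplacian_eq_zero hG o h.2 q x))),
      fun c => ⟨⟨fun _ => c, laplacian_const o c⟩, rfl⟩⟩

lemma finrank_range_add_finrank_ker {M N : Type*} [AddCommGroup M] [AddCommGroup N]
    [Module.Finite ℤ M] (f : M →ₗ[ℤ] N) :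
    Module.finrank ℤ (LinearMap.range f) + Module.finrank ℤ (LinearMap.ker f) =
      Module.finrank ℤ M := by
  rw [← f.quotKerEquivRange.finrank_eq]
  exact Submodule.finrank_quotient_add_finrank _

lemma finrank_jac [G.Loopless] (hG : G.toSimpleGraph.Connected) (o : Orientation G) :
    Module.finrank ℤ (Jac o) = 1 := by
  obtain ⟨q⟩ := hG.nonempty
  have h1 : Module.finrank ℤ (Jac o) + Module.finrank ℤ (LinearMap.range (laplacian o)) =
      Module.finrank ℤ (Divisor G) := Submodule.finrank_quotient_add_finrank (prin o)
  have h2 := GraphRR.finrank_range_add_finrank_ker (laplacian o)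
  rw [(kerLaplacianEquiv hG o q).finrank_eq, Module.finrank_self] at h2
  omega

/-- On a connected graph, every divisor of degree zero has a nonzero principal multiple. -/
lemma exists_smul_mem_prin [G.Loopless] (hG : G.toSimpleGraph.Connected) (o : Orientation G)
    {D : Divisor G} (hD : deg D = 0) : ∃ N : ℤ, N ≠ 0 ∧ N • D ∈ prin o := by
  classical
  obtain ⟨q⟩ := hG.nonempty
  by_contra! hcon
  -- Otherwise D and the point q would be independent in Jac, which has rank 1: the degree kills the
  -- coefficient of q, and the assumption that of D.
  have hli : LinearIndependent ℤ ![(prin o).mkQ D, (prin o).mkQ (Pi.single q 1)] := by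
    rw [LinearIndependent.pair_iff]
    intro a b hab
    rw [← map_smul, ← map_smul, ← map_add, Submodule.mkQ_apply,
      Submodule.Quotient.mk_eq_zero] at hab
    have hb := deg_eq_zero_of_mem_prin hab
    rw [deg_add, deg_smul, deg_smul, hD, deg_single] at hb
    obtain rfl : b = 0 := by linarith
    refine ⟨by_contra fun ha => hcon a ha (by simpa using hab), rfl⟩
  have := hli.fintype_card_le_finrank
  rw [finrank_jac hG o] at this
  simp at this

lemma masterEulerChar_eq (o : Orientation G) : masterEulerChar o = 1 - genus G := by
  have h1 := Submodule.finrank_quotient_add_finrank (LinearMap.range (boundary o))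
  have h2 := GraphRR.finrank_range_add_finrank_ker (boundary o)
  rw [Module.finrank_fintype_fun_eq_card] at h1 h2
  unfold masterEulerChar genus
  omega

/-! ### Reduced divisors -/

/-- If `f` is minimal at `x`, its Laplacian is nonpositive there. -/
lemma laplacian_nonpos_of_forall_le (o : Orientation G) {f : Divisor G} {x : V(G)}
    (h : ∀ y, f x ≤ f y) : laplacian o f x ≤ 0 := by
  classical
  rw [laplacian_apply]
  refine Finset.sum_nonpos fun e _ => ?_
  have h1 := h (o.head e)
  have h2 := h (o.tail e)
  split_ifs with h3 h4 h4 <;> subst_vars <;> simp_all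

/-- Such an h serves twice in `exists_reduced`: large multiples of Lh remove debt away from q, and h
is the weight of a potential that firing lowers. -/
lemma exists_laplacian_pos [G.Loopless] (hG : G.toSimpleGraph.Connected) (o : Orientation G)
    (q : V(G)) : ∃ h : Divisor G, 0 ≤ h ∧ h q = 0 ∧ ∀ x, x ≠ q → 1 ≤ laplacian o h x := by
  classical
  let D : Divisor G := (fun _ => 1) - Pi.single q (Fintype.card V(G) : ℤ)
  have hD : deg D = 0 := by
    rw [deg_sub, deg_single]
    simp [deg]
  obtain ⟨N, hN, f, hf⟩ := exists_smul_mem_prin hG o hD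
  -- The extra factor N makes Lh = N² away from q, whatever the sign of N; the constant normalises h
  -- q = 0. Then h ≥ 0, since its minimum cannot lie where Lh > 0.
  let h : Divisor G := N • f - fun _ => (N • f) q
  have hlap : ∀ x, x ≠ q → 1 ≤ laplacian o h x := by
    intro x hx
    have : laplacian o h x = N * N := by
      simp only [h, map_sub, map_smul, laplacian_const, hf]
      simp [D, hx]
    rw [this]
    have := mul_self_pos.2 hN
    omega
  have hq : h q = 0 := by simp [h]
  refine ⟨h, fun y => ?_, hq, hlap⟩
  obtain ⟨x, -, hx⟩ := Finset.exists_min_image Finset.univ h ⟨q, Finset.mem_univ q⟩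
  have hxq : x = q := by
    by_contra hne
    have h1 := hlap x hne
    have h2 := laplacian_nonpos_of_forall_le o (f := h) (x := x) (fun y => hx y (Finset.mem_univ y))
    omega
  have := hx y (Finset.mem_univ y)
  rw [hxq, hq] at this
  exact this

/-- The indicator function of a set of vertices. -/
noncomputable def indicatorDivisor (A : Finset V(G)) : Divisor G :=
  Set.indicator (A : Set V(G)) 1

/-- Every divisor is linearly equivalent to a `q`-reduced one. -/
lemma exists_reduced [G.Loopless] (hG : G.toSimpleGraph.Connected) (o : Orientation G)
    (q : V(G)) (D : Divisor G) : ∃ φ ∈ prin o, (∀ x, x ≠ q → 0 ≤ (D - φ) x) ∧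
      ∀ A : Finset V(G), A.Nonempty → q ∉ A →
        ∃ x ∈ A, (D - φ) x < laplacian o (indicatorDivisor A) x := by
  classical
  obtain ⟨h, h0, hq, hpos⟩ := exists_laplacian_pos hG o q
  let S : Set (Divisor G) := {φ | φ ∈ prin o ∧ ∀ x, x ≠ q → 0 ≤ (D - φ) x}
  have hS : S.Nonempty := by
    let c : ℤ := ∑ x, |D x|
    have hc : ∀ x, |D x| ≤ c := fun x =>
      Finset.single_le_sum (f := fun x => |D x|) (fun i _ => abs_nonneg _) (Finset.mem_univ x)
    refine ⟨laplacian o ((-c) • h), ⟨_, rfl⟩, fun x hx => ?_⟩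
    rw [map_smul]
    have h1 := hpos x hx
    have h2 := hc x
    have h3 := neg_abs_le (D x)
    have h4 : 0 ≤ |D x| := abs_nonneg _
    simp only [Pi.sub_apply, Pi.smul_apply, smul_eq_mul]
    nlinarith
  -- Firing a set A that avoids q changes this potential by −⟨h, L1_A⟩ = −∑_{x ∈ A} (Lh)(x) < 0. A
  -- minimiser over S therefore admits no legal firing, which is what reducedness says.
  let pot : Divisor G → ℤ := fun φ => ∑ x, h x * (D - φ) x
  have hpot : ∀ φ ∈ S, 0 ≤ pot φ := fun φ hφ => Finset.sum_nonneg fun x _ => by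
    by_cases hx : x = q
    · rw [hx, hq, zero_mul]
    · exact mul_nonneg (h0 x) (hφ.2 x hx)
  obtain ⟨φ, hφ, hmin⟩ : ∃ φ ∈ S, ∀ ψ ∈ S, (pot φ).toNat ≤ (pot ψ).toNat := by
    have hw := (measure fun φ : Divisor G => (pot φ).toNat).wf
    exact ⟨hw.min S hS, hw.min_mem S hS, fun ψ hψ => not_lt.1 (hw.not_lt_min S hψ)⟩
  refine ⟨φ, hφ.1, hφ.2, fun A hA hqA => ?_⟩
  by_contra! hcon
  let ψ := φ + laplacian o (indicatorDivisor A)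
  have hψ : ψ ∈ S := by
    refine ⟨add_mem hφ.1 ⟨_, rfl⟩, fun x hx => ?_⟩
    have key : (D - ψ) x = (D - φ) x - laplacian o (indicatorDivisor A) x := by
      simp only [ψ, Pi.sub_apply, Pi.add_apply]; ring
    rw [key]
    by_cases hxA : x ∈ A
    · have := hcon x hxA
      omega
    · have := laplacian_nonpos_of_forall_le o (f := indicatorDivisor A) (x := x) (fun y => by
        simp only [indicatorDivisor]
        rw [Set.indicator_of_notMem (by simpa using hxA)]
        exact Set.indicator_nonneg (fun _ _ => zero_le_one) y)
      have := hφ.2 x hx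
      omega
  have hlt : pot ψ < pot φ := by
    have h1 : pot ψ = pot φ - ∑ x, h x * laplacian o (indicatorDivisor A) x := by
      simp only [pot, ← Finset.sum_sub_distrib, ψ]
      refine Finset.sum_congr rfl fun x _ => ?_
      simp only [Pi.sub_apply, Pi.add_apply]; ring
    rw [h1, sum_mul_laplacian_comm]
    have h2 : 0 < ∑ x, indicatorDivisor A x * laplacian o h x := by
      have : ∀ x, indicatorDivisor A x * laplacian o h x =
          if x ∈ A then laplacian o h x else 0 := by
        intro x; simp [indicatorDivisor, Set.indicator_apply]
      simp_rw [this]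
      rw [← Finset.sum_filter]
      refine Finset.sum_pos (fun x hx => ?_) ?_
      · have hxA : x ∈ A := by simpa using hx
        have := hpos x (fun hh => hqA (hh ▸ hxA))
        omega
      · simpa using hA
    omega
  have := hmin ψ hψ
  have h3 := hpot ψ hψ
  omega

/-! ### Divisors of acyclic orientations -/

open Classical in
/-- The number of edges at `x` whose other end has a smaller value of `p`. -/
noncomputable def lowerDegree (o : Orientation G) (p : V(G) → ℤ) (x : V(G)) : ℤ :=
  ∑ e, ((if o.head e = x ∧ p (o.tail e) < p (o.head e) then 1 else 0) +
    (if o.tail e = x ∧ p (o.head e) < p (o.tail e) then 1 else 0))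

/-- The divisor of the acyclic orientation along which `p` increases. -/
noncomputable def acyclicDivisor (o : Orientation G) (p : V(G) → ℤ) : Divisor G :=
  fun x => lowerDegree o p x - 1

/-- Each edge is counted exactly once, at its end with the larger label. -/
lemma deg_acyclicDivisor [G.Loopless] (o : Orientation G) {p : V(G) → ℤ}
    (hp : Function.Injective p) : deg (acyclicDivisor o p) = genus G - 1 := by
  classical
  have : ∑ x, lowerDegree o p x = Fintype.card E(G) := by
    simp only [lowerDegree]
    rw [Finset.sum_comm, Fintype.card_eq_sum_ones, Nat.cast_sum]
    refine Finset.sum_congr rfl fun e _ => ?_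
    have hne := hp.ne (o.head_ne_tail e)
    simp only [ite_and, Finset.sum_add_distrib, Finset.sum_ite_eq, Finset.mem_univ, if_true]
    rcases lt_or_gt_of_ne hne with h | h <;> simp [h, h.not_gt]
  simp [deg, acyclicDivisor, this, genus]

lemma canonicalDivisor_apply [G.Loopless] (o : Orientation G) (x : V(G)) [DecidableEq V(G)] :
    canonicalDivisor G x =
      ∑ e, ((if o.head e = x then 1 else 0) + (if o.tail e = x then 1 else 0)) - 2 := by
  classical
  have hset : G.incidenceSet (x : α) =
      ((Finset.univ.filter fun e => o.head e = x ∨ o.tail e = x).map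
        (Function.Embedding.subtype _) : Finset β) := by
    ext e
    simp only [Graph.mem_incidenceSet, Finset.coe_map, Function.Embedding.subtype_apply,
      Finset.coe_filter, Finset.mem_univ, true_and, Set.mem_image, Set.mem_ofPred_eq,
      Subtype.exists, exists_and_right, exists_eq_right]
    constructor
    · intro h
      refine ⟨h.edge_mem, ?_⟩
      rcases h.eq_or_eq_of_isLink (o.isLink ⟨e, h.edge_mem⟩) with h | h
      · exact Or.inr (Subtype.ext h.symm)
      · exact Or.inl (Subtype.ext h.symm)
    · rintro ⟨he, h | h⟩
      · rw [← h]; exact (o.isLink ⟨e, he⟩).inc_right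
      · rw [← h]; exact (o.isLink ⟨e, he⟩).inc_left
  rw [canonicalDivisor, hset, Set.ncard_coe_finset, Finset.card_map, Finset.card_filter]
  push_cast
  congr 1
  refine Finset.sum_congr rfl fun e _ => ?_
  have := o.head_ne_tail e
  by_cases h1 : o.head e = x <;> by_cases h2 : o.tail e = x <;> simp_all

lemma acyclicDivisor_add_neg [G.Loopless] (o : Orientation G) {p : V(G) → ℤ}
    (hp : Function.Injective p) :
    acyclicDivisor o p + acyclicDivisor o (-p) = canonicalDivisor G := by
  classical
  ext x
  rw [canonicalDivisor_apply o]
  have : lowerDegree o p x + lowerDegree o (-p) x =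
      ∑ e, ((if o.head e = x then 1 else 0) + (if o.tail e = x then 1 else 0)) := by
    simp only [lowerDegree, ← Finset.sum_add_distrib, Pi.neg_apply, neg_lt_neg_iff]
    refine Finset.sum_congr rfl fun e _ => ?_
    have hne := hp.ne (o.head_ne_tail e)
    rcases lt_or_gt_of_ne hne with h | h <;> simp [h, h.not_gt, add_comm]
  simp only [Pi.add_apply, acyclicDivisor]
  rw [← this]
  ring

/-- The divisor of an acyclic orientation is not equivalent to an effective one. -/
lemma acyclicDivisor_not_effective [G.Loopless] (hG : G.toSimpleGraph.Connected)
    (o : Orientation G) (p : V(G) → ℤ) :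
    ¬ ∃ φ ∈ prin o, 0 ≤ acyclicDivisor o p - φ := by
  classical
  rintro ⟨_, ⟨f, rfl⟩, h⟩
  obtain ⟨q⟩ := hG.nonempty
  -- Take x of least label among the maximisers of f. Each edge to a lower label then drops f by at
  -- least 1 and no edge raises it, so (Lf)(x) ≥ indegree, and ν_p − Lf is negative at x.
  obtain ⟨m, -, hm⟩ := Finset.exists_max_image Finset.univ f ⟨q, Finset.mem_univ q⟩
  obtain ⟨x, hx, hpx⟩ := Finset.exists_min_image (Finset.univ.filter fun y => f y = f m) p
    ⟨m, by simp⟩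
  replace hx : f x = f m := by simpa using hx
  have hfx : ∀ y, f y ≤ f x := fun y => hx ▸ hm y (Finset.mem_univ y)
  have hlt : ∀ y, p y < p x → f y + 1 ≤ f x := by
    intro y hy
    by_contra hcon
    have := hpx y (by simp only [Finset.mem_filter, Finset.mem_univ, true_and]; linarith [hfx y])
    omega
  have h1 : lowerDegree o p x ≤ laplacian o f x := by
    rw [laplacian_apply, lowerDegree]
    refine Finset.sum_le_sum fun e _ => ?_
    have hne := o.head_ne_tail e
    by_cases hh : o.head e = x
    · have ht : o.tail e ≠ x := fun h' => hne (hh.trans h'.symm)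
      have a1 := hfx (o.tail e)
      have a2 := hlt (o.tail e)
      simp only [hh, ht, true_and, false_and, if_true, if_false]
      split_ifs with h3
      · have := a2 h3; omega
      · omega
    · by_cases ht : o.tail e = x
      · have a1 := hfx (o.head e)
        have a2 := hlt (o.head e)
        simp only [hh, ht, true_and, false_and, if_true, if_false]
        split_ifs with h3
        · have := a2 h3; omega
        · omega
      · simp [hh, ht]
  have h2 := h x
  simp only [Pi.sub_apply, Pi.zero_apply, acyclicDivisor] at h2
  omega

/-! ### Burning -/

/-- Dhar's burning algorithm. -/
lemma exists_burning_order (o : Orientation G) [G.Loopless] {q : V(G)} {D : Divisor G}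
    (hD : ∀ A : Finset V(G), A.Nonempty → q ∉ A →
      ∃ x ∈ A, D x < laplacian o (indicatorDivisor A) x) (n : ℕ) :
    ∀ A : Finset V(G), A.card = n → q ∉ A → ∃ p : V(G) → ℤ, Set.InjOn p A ∧
      (∀ x ∉ A, p x = 0) ∧ ∀ x ∈ A, 0 < p x ∧ D x < lowerDegree o p x := by
  classical
  induction n with
  | zero =>
    intro A hA _
    obtain rfl := Finset.card_eq_zero.1 hA
    exact ⟨0, by simp, by simp, by simp⟩
  | succ n ih =>
    intro A hA hqA
    obtain ⟨x, hxA, hx⟩ := hD A (Finset.card_pos.1 (by omega)) hqA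
    obtain ⟨p, hinj, hzero, hp⟩ := ih (A.erase x) (by rw [Finset.card_erase_of_mem hxA]; omega)
      (fun h => hqA (Finset.mem_of_mem_erase h))
    have hpx : p x = 0 := hzero x (by simp)
    have hpos : ∀ y ∈ A, y ≠ x → 0 < p y := fun y hy hyx =>
      (hp y (Finset.mem_erase.2 ⟨hyx, hy⟩)).1
    have hnn : ∀ y, 0 ≤ p y := fun y => by
      by_cases hy : y ∈ A.erase x
      · exact (hp y hy).1.le
      · exact (hzero y hy).ge
    have hz : ∀ y ∉ A, p y = 0 := fun y hy => hzero y fun h => hy (Finset.mem_of_mem_erase h)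
    -- The labels on A \ {x} move up by one and x takes the freed label 1, below the rest of A and
    -- above its complement. The lower neighbours of x are then those outside A, counted with
    -- multiplicity by L1_A at x.
    refine ⟨fun y => if y ∈ A then p y + 1 else 0, ?_, fun y hy => by simp [hy], ?_⟩
    · intro y hy z hz hyz
      simp only [Finset.mem_coe] at hy hz
      simp only [hy, hz, if_true, add_left_inj] at hyz
      by_cases h1 : y = x
      · by_cases h2 : z = x
        · rw [h1, h2]
        · have := hpos z hz h2
          rw [h1] at hyz; omega
      · by_cases h2 : z = x
        · have := hpos y hy h1
          rw [h2] at hyz; omega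
        · exact hinj (by simp [h1, hy]) (by simp [h2, hz]) hyz
    · intro y hy
      refine ⟨by simp only [hy, if_true]; linarith [hnn y], ?_⟩
      by_cases hyx : y = x
      · subst hyx
        refine hx.trans_le ?_
        rw [laplacian_apply, lowerDegree]
        refine Finset.sum_le_sum fun e _ => ?_
        have hne := o.head_ne_tail e
        have key : ∀ z, z ≠ y → (1 - indicatorDivisor A z ≤
            if (if z ∈ A then p z + 1 else 0) < (1 : ℤ) then 1 else 0) := by
          intro z hz
          by_cases hzA : z ∈ A <;> simp [indicatorDivisor, hzA, (hnn z).not_gt]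
        have hAy : indicatorDivisor A y = 1 := by simp [indicatorDivisor, hy]
        by_cases hh : o.head e = y
        · have ht : o.tail e ≠ y := fun h' => hne (hh.trans h'.symm)
          have := key _ ht
          simpa [hh, ht, hy, hpx, hAy] using this
        · by_cases ht : o.tail e = y
          · have := key _ hh
            simpa [hh, ht, hy, hpx, hAy] using this
          · simp [hh, ht]
      · refine (hp y (Finset.mem_erase.2 ⟨hyx, hy⟩)).2.trans_le ?_
        have hpy := hpos y hy hyx
        -- For y ≠ x the relabelling keeps every lower neighbour lower, so the old bound persists.
        have key : ∀ z, p z < p y → (if z ∈ A then p z + 1 else 0) < p y + 1 := by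
          intro z hz
          split_ifs <;> omega
        rw [lowerDegree, lowerDegree]
        refine Finset.sum_le_sum fun e _ => add_le_add ?_ ?_
        · by_cases hh : o.head e = y
          · by_cases hlt : p (o.tail e) < p y
            · simp [hh, hy, hlt, key _ hlt]
            · simp only [hh, hlt, and_false, if_false]
              split_ifs <;> simp
          · simp [hh]
        · by_cases hh : o.tail e = y
          · by_cases hlt : p (o.head e) < p y
            · simp [hh, hy, hlt, key _ hlt]
            · simp only [hh, hlt, and_false, if_false]
              split_ifs <;> simp
          · simp [hh]

/-- A divisor is equivalent to an effective one unless it is dominated, up to equivalence, by the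
divisor of an acyclic orientation. -/
lemma exists_acyclicDivisor_of_not_effective [G.Loopless] (hG : G.toSimpleGraph.Connected)
    (o : Orientation G) {D : Divisor G} (hD : ¬ ∃ φ ∈ prin o, 0 ≤ D - φ) :
    ∃ p : V(G) → ℤ, Function.Injective p ∧ ∃ φ ∈ prin o, 0 ≤ acyclicDivisor o p - (D - φ) := by
  classical
  obtain ⟨q⟩ := hG.nonempty
  obtain ⟨φ, hφ, hnonneg, hred⟩ := exists_reduced hG o q D
  obtain ⟨p, hinj, hzero, hp⟩ := exists_burning_order o hred _ (Finset.univ.erase q) rfl (by simp)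
  have hpq : p q = 0 := hzero q (by simp)
  have hpos : ∀ x, x ≠ q → 0 < p x := fun x hx => (hp x (by simp [hx])).1
  refine ⟨p, fun x y hxy => ?_, φ, hφ, fun x => ?_⟩
  · by_cases hx : x = q
    · by_cases hy : y = q
      · rw [hx, hy]
      · have := hpos y hy
        rw [hx] at hxy; omega
    · by_cases hy : y = q
      · have := hpos x hx
        rw [hy] at hxy; omega
      · exact hinj (by simp [hx]) (by simp [hy]) hxy
  · by_cases hx : x = q
    · subst hx
      -- At q the value is at most −1, since D would otherwise be equivalent to an effective
      -- divisor, while ν_p ≥ −1 everywhere.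
      have hneg : (D - φ) x < 0 := by
        by_contra hcon
        refine hD ⟨φ, hφ, fun y => ?_⟩
        by_cases hy : y = x
        · rw [hy]; exact not_lt.1 hcon
        · exact hnonneg y hy
      have : 0 ≤ lowerDegree o p x :=
        Finset.sum_nonneg fun e _ => add_nonneg (by split_ifs <;> simp) (by split_ifs <;> simp)
      change 0 ≤ lowerDegree o p x - 1 - (D - φ) x
      omega
    · have := (hp x (by simp [hx])).2
      change 0 ≤ lowerDegree o p x - 1 - (D - φ) x
      omega

/-! ### The rank and Riemann–Roch -/

lemma bddAbove_rankSet (o : Orientation G) [Nonempty V(G)] (D : Divisor G) :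
    BddAbove (rankSet o D) := by
  classical
  refine ⟨|deg D|, ?_⟩
  rintro k ⟨-, h⟩
  by_contra! hlt
  have hk0 : 0 ≤ k := (abs_nonneg _).trans hlt.le
  obtain ⟨q⟩ := ‹Nonempty V(G)›
  obtain ⟨φ, hφ, hE⟩ := h (Pi.single q k) (by simpa using hk0) (deg_single q k)
  have := deg_nonneg hE
  rw [deg_sub, deg_sub, deg_single, deg_eq_zero_of_mem_prin hφ] at this
  have := le_abs_self (deg D)
  omega

lemma neg_one_mem_rankSet (o : Orientation G) (D : Divisor G) : -1 ∈ rankSet o D := by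
  refine ⟨le_rfl, fun E hE hdeg => ?_⟩
  have := deg_nonneg hE
  omega

lemma isGreatest_rank (o : Orientation G) [Nonempty V(G)] (D : Divisor G) :
    IsGreatest (rankSet o D) (rank o D) :=
  ⟨Int.csSup_mem ⟨-1, neg_one_mem_rankSet o D⟩ (bddAbove_rankSet o D),
    fun _ hk => le_csSup (bddAbove_rankSet o D) hk⟩

/-- Pad a test divisor of degree j to degree k with chips at q, then give those chips back. -/
lemma mem_rankSet_of_le (o : Orientation G) [Nonempty V(G)] {D : Divisor G} {j k : ℤ}
    (hk : k ∈ rankSet o D) (hj : -1 ≤ j) (hjk : j ≤ k) : j ∈ rankSet o D := by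
  classical
  obtain ⟨q⟩ := ‹Nonempty V(G)›
  refine ⟨hj, fun E hE hdeg => ?_⟩
  have hs : (0 : Divisor G) ≤ Pi.single q (k - j) := by simpa using hjk
  obtain ⟨φ, hφ, h⟩ := hk.2 (E + Pi.single q (k - j)) (add_nonneg hE hs)
    (by rw [deg_add, deg_single, hdeg]; ring)
  refine ⟨φ, hφ, (add_nonneg h hs).trans_eq ?_⟩
  abel

/-- One half of the Riemann–Roch theorem. -/
lemma le_rank_sub_rank [G.Loopless] (hG : G.toSimpleGraph.Connected) (o : Orientation G)
    (D : Divisor G) :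
    deg D + 1 - genus G ≤ rank o D - rank o (canonicalDivisor G - D) := by
  have := hG.nonempty
  have hD := isGreatest_rank o D
  have hK := isGreatest_rank o (canonicalDivisor G - D)
  have hge := hD.1.1
  obtain ⟨E, hE, hdegE, hno⟩ : ∃ E : Divisor G, 0 ≤ E ∧ deg E = rank o D + 1 ∧
      ¬ ∃ φ ∈ prin o, 0 ≤ D - E - φ := by
    by_contra! hcon
    have : rank o D + 1 ∈ rankSet o D := by
      refine ⟨by omega, fun E hE hdeg => ?_⟩
      obtain ⟨φ, hφ, h⟩ := hcon E hE hdeg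
      exact ⟨φ, hφ, h.trans_eq (by abel)⟩
    have := hD.2 this
    omega
  obtain ⟨p, hp, φ, hφ, hF⟩ := exists_acyclicDivisor_of_not_effective hG o hno
  set F := acyclicDivisor o p - (D - E - φ) with hFdef
  have hdegF : deg F = genus G - 1 - deg D + rank o D + 1 := by
    rw [hFdef, deg_sub, deg_sub, deg_sub, deg_acyclicDivisor o hp, hdegE,
      deg_eq_zero_of_mem_prin hφ]
    ring
  by_contra! hlt
  have hmem : deg F ∈ rankSet o (canonicalDivisor G - D) :=
    mem_rankSet_of_le o hK.1 (by have := deg_nonneg hF; omega) (by omega)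
  obtain ⟨ψ, hψ, h⟩ := hmem.2 F hF rfl
  -- Here (K − D − ψ − F) + E = ν_{−p} − (ψ + φ), because ν_p + ν_{−p} = K.
  refine acyclicDivisor_not_effective hG o (-p) ⟨ψ + φ, add_mem hψ hφ, ?_⟩
  refine (add_nonneg h hE).trans_eq ?_
  rw [← acyclicDivisor_add_neg o hp, hFdef]
  abel

lemma deg_canonicalDivisor [G.Loopless] (o : Orientation G) :
    deg (canonicalDivisor G) = 2 * genus G - 2 := by
  obtain ⟨p, hp⟩ : ∃ p : V(G) → ℤ, Function.Injective p :=
    ⟨fun x => (Fintype.equivFin V(G) x : ℕ), fun x y h => by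
      simpa [Fin.val_inj] using h⟩
  rw [← acyclicDivisor_add_neg o hp, deg_add, deg_acyclicDivisor o hp,
    deg_acyclicDivisor o (p := -p) (neg_injective.comp hp)]
  ring

/-- The Riemann–Roch theorem for graphs. -/
theorem rank_sub_rank_canonicalDivisor_sub [G.Loopless] (hG : G.toSimpleGraph.Connected)
    (o : Orientation G) (D : Divisor G) :
    rank o D - rank o (canonicalDivisor G - D) = deg D + 1 - genus G := by
  have h1 := le_rank_sub_rank hG o D
  have h2 := le_rank_sub_rank hG o (canonicalDivisor G - D)
  rw [sub_sub_cancel, deg_sub, deg_canonicalDivisor o] at h2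
  omega

/-! ### Functionals on principal divisors and the torsion of the Jacobian -/

/-- On a connected graph, the torsion classes are those of degree zero. -/
lemma mem_torsion_jac_iff [G.Loopless] (hG : G.toSimpleGraph.Connected) (o : Orientation G)
    (D : Divisor G) : (prin o).mkQ D ∈ Submodule.torsion ℤ (Jac o) ↔ deg D = 0 := by
  constructor
  · rintro ⟨⟨a, ha⟩, h⟩
    change a • (prin o).mkQ D = 0 at h
    rw [← map_smul, Submodule.mkQ_apply, Submodule.Quotient.mk_eq_zero] at h
    have := deg_eq_zero_of_mem_prin h
    rw [deg_smul] at this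
    exact (mul_eq_zero.1 this).resolve_left (nonZeroDivisors.ne_zero ha)
  · intro h
    obtain ⟨N, hN, hmem⟩ := exists_smul_mem_prin hG o h
    refine ⟨⟨N, mem_nonZeroDivisors_of_ne_zero hN⟩, ?_⟩
    change N • (prin o).mkQ D = 0
    rwa [← map_smul, Submodule.mkQ_apply, Submodule.Quotient.mk_eq_zero]

/-- The Laplacian as a map onto the principal divisors. -/
noncomputable def toPrin (o : Orientation G) : Divisor G →ₗ[ℤ] prin o :=
  (laplacian o).rangeRestrict

lemma toPrin_surjective (o : Orientation G) : Function.Surjective (toPrin o) :=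
  (laplacian o).surjective_rangeRestrict

lemma toPrin_eq_zero {o : Orientation G} {f : Divisor G} :
    toPrin o f = 0 ↔ laplacian o f = 0 :=
  Subtype.ext_iff

open Classical in
/-- The map sending a functional on `Prin(G)` to the class of the divisor that represents its
composition with the Laplacian. -/
noncomputable def dualPrinToJac (o : Orientation G) : (prin o →ₗ[ℤ] ℤ) →ₗ[ℤ] Jac o :=
  (prin o).mkQ ∘ₗ LinearMap.pi fun x => LinearMap.applyₗ (toPrin o (Pi.single x 1))

open Classical in
lemma linearMap_divisor_apply (c : Divisor G →ₗ[ℤ] ℤ) (D : Divisor G) :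
    c D = ∑ x, D x * c (Pi.single x 1) := by
  conv_lhs => rw [← Finset.univ_sum_single D]
  rw [map_sum]
  refine Finset.sum_congr rfl fun x _ => ?_
  rw [← smul_eq_mul, ← map_smul, ← Pi.single_smul, smul_eq_mul, mul_one]

open Classical in
lemma laplacian_linearMap_single (o : Orientation G) (c : Divisor G →ₗ[ℤ] ℤ) :
    laplacian o (fun x => c (Pi.single x 1)) =
      fun x => c (laplacian o (Pi.single x 1)) := by
  ext x
  rw [linearMap_divisor_apply c]
  simp_rw [mul_comm (laplacian o (Pi.single x 1) _)]
  rw [sum_mul_laplacian_comm]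
  simp [Pi.single_apply]

/-- By symmetry of L, the vector x ↦ ψ(Lδ_x) equals Ld exactly when ψ(Lf) = ⟨d, Lf⟩ for all f, that
is, when ψ is the restriction of ⟨d, −⟩. -/
lemma ker_dualPrinToJac (o : Orientation G) :
    LinearMap.ker (dualPrinToJac o) = LinearMap.range (LinearMap.lcomp ℤ ℤ (prin o).subtype) := by
  classical
  ext ψ
  rw [LinearMap.mem_ker, dualPrinToJac, LinearMap.comp_apply, Submodule.mkQ_apply,
    Submodule.Quotient.mk_eq_zero]
  constructor
  · rintro ⟨d, hd⟩
    refine ⟨∑ x, d x • LinearMap.proj x, LinearMap.ext fun φ => ?_⟩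
    obtain ⟨f, rfl⟩ := toPrin_surjective o φ
    have h1 : ψ (toPrin o f) = _ := linearMap_divisor_apply (ψ ∘ₗ toPrin o) f
    have h2 : ∀ x, (ψ ∘ₗ toPrin o) (Pi.single x 1) = laplacian o d x :=
      fun x => (congrFun hd x).symm
    simp_rw [h2] at h1
    rw [h1, sum_mul_laplacian_comm]
    simp only [LinearMap.lcomp_apply, Submodule.subtype_apply, LinearMap.sum_apply,
      LinearMap.smul_apply, LinearMap.proj_apply, smul_eq_mul]
    rfl
  · rintro ⟨c, rfl⟩
    exact ⟨_, laplacian_linearMap_single o c⟩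

/-- A functional ⟨D, −⟩ on Div factors through L exactly when it kills ker L, the constants, which
means deg D = 0. -/
lemma range_dualPrinToJac [G.Loopless] (hG : G.toSimpleGraph.Connected) (o : Orientation G) :
    LinearMap.range (dualPrinToJac o) = Submodule.torsion ℤ (Jac o) := by
  classical
  apply le_antisymm
  · rintro _ ⟨ψ, rfl⟩
    refine (mem_torsion_jac_iff hG o _).2 ?_
    have h := linearMap_divisor_apply (ψ ∘ₗ toPrin o) (fun _ => 1)
    rw [LinearMap.comp_apply, toPrin_eq_zero.2 (laplacian_const o 1), map_zero] at h
    simpa [deg] using h.symm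
  · intro y hy
    obtain ⟨D, rfl⟩ := (prin o).mkQ_surjective y
    rw [mem_torsion_jac_iff hG o] at hy
    let c : Divisor G →ₗ[ℤ] ℤ := ∑ x, D x • LinearMap.proj x
    have hc : ∀ f, c f = ∑ x, f x * D x := fun f => by simp [c, mul_comm]
    have hker : LinearMap.ker (toPrin o) ≤ LinearMap.ker c := by
      intro f hf
      rw [LinearMap.mem_ker, toPrin_eq_zero] at hf
      obtain ⟨q⟩ := hG.nonempty
      rw [LinearMap.mem_ker, hc]
      simp_rw [fun x => eq_of_laplacian_eq_zero hG o hf x q]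
      rw [← Finset.mul_sum]
      exact mul_eq_zero_of_right _ hy
    let e := (toPrin o).quotKerEquivOfSurjective (toPrin_surjective o)
    refine ⟨(LinearMap.ker (toPrin o)).liftQ c hker ∘ₗ e.symm.toLinearMap, ?_⟩
    rw [dualPrinToJac, LinearMap.comp_apply]
    congr 1
    ext x
    change (LinearMap.ker (toPrin o)).liftQ c hker
      (e.symm (e (Submodule.Quotient.mk (Pi.single x 1)))) = D x
    rw [LinearEquiv.symm_apply_apply, Submodule.liftQ_apply, hc]
    simp [Pi.single_apply]

open Classical in
/-- The functionals on `Div(G)` vanishing on `Prin(G)` are the multiples of the degree. -/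
noncomputable def kerRestrictEquiv [G.Loopless] (hG : G.toSimpleGraph.Connected)
    (o : Orientation G) (q : V(G)) :
    LinearMap.ker (LinearMap.lcomp ℤ ℤ (prin o).subtype) ≃ₗ[ℤ] ℤ :=
  LinearEquiv.ofBijective
    (LinearMap.applyₗ (Pi.single q 1) ∘ₗ
      (LinearMap.ker (LinearMap.lcomp ℤ ℤ (prin o).subtype)).subtype) <| by
    constructor
    · rw [injective_iff_map_eq_zero]
      rintro ⟨c, hc⟩ h
      have hc' : ∀ f, c (laplacian o f) = 0 := fun f => LinearMap.congr_fun hc (toPrin o f)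
      replace h : c (Pi.single q 1) = 0 := h
      have hL := laplacian_linearMap_single o c
      simp_rw [hc'] at hL
      refine Subtype.ext (LinearMap.ext fun D => ?_)
      change c D = 0
      rw [linearMap_divisor_apply]
      refine Finset.sum_eq_zero fun x _ => ?_
      rw [eq_of_laplacian_eq_zero hG o hL x q, h, mul_zero]
    · intro n
      have hdeg : ∀ D, (n • ∑ x, LinearMap.proj x : Divisor G →ₗ[ℤ] ℤ) D = n * deg D :=
        fun D => by simp [deg]
      refine ⟨⟨n • ∑ x, LinearMap.proj x, LinearMap.ext fun φ => ?_⟩, ?_⟩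
      · change (n • ∑ x, LinearMap.proj x : Divisor G →ₗ[ℤ] ℤ) φ = 0
        rw [hdeg, deg_eq_zero_of_mem_prin φ.2, mul_zero]
      · change (n • ∑ x, LinearMap.proj x : Divisor G →ₗ[ℤ] ℤ) (Pi.single q 1) = n
        rw [hdeg, deg_single, mul_one]

end Combinatorics

/-! ### Morphisms out of a cone in the derived category -/

section DerivedDual

open Limits Pretriangulated

section Cone

variable {C : Type u} [Category.{v} C] [Abelian C] [HasDerivedCategory.{w} C]

/-- Projective objects have no nonzero shifted morphisms in the derived category. -/
lemma shiftedHom_eq_zero_of_projective {P Z : C} [Projective P] {k : ℤ} (hk : k ≠ 0)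
    (φ : (DerivedCategory.singleFunctor C 0).obj P ⟶
      ((DerivedCategory.singleFunctor C 0).obj Z)⟦k⟧) : φ = 0 := by
  rw [← cancel_mono (((DerivedCategory.singleFunctors C).shiftIso k (-k) 0
    (by lia)).hom.app _), Limits.zero_comp]
  -- The target is now Z placed in degree −k: for k < 0 the t-structure gives the vanishing, for k >
  -- 0 projectivity of P does.
  rcases lt_or_gt_of_ne hk with hk | hk
  · exact DerivedCategory.TStructure.t.zero_of_isLE_of_isGE _ 0 (-k) (by lia)
      (inferInstanceAs (((DerivedCategory.singleFunctor C 0).obj P).IsLE 0))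
      (inferInstanceAs (((DerivedCategory.singleFunctor C (-k)).obj Z).IsGE (-k)))
  · exact DerivedCategory.from_singleFunctor_obj_eq_zero_of_projective
      (L := (CochainComplex.singleFunctor C (-k)).obj Z) _ (-k) (by lia)

/-- The mapping cone of a morphism of objects in degree `0`. -/
noncomputable abbrev singleCone {X Y : C} (f : X ⟶ Y) : CochainComplex C ℤ :=
  CochainComplex.mappingCone ((CochainComplex.singleFunctor C 0).map f)

variable {X Y : C} (f : X ⟶ Y)

/-- The inclusion of `Y` into the cone of `f : X ⟶ Y` in the derived category. -/
noncomputable def coneInr :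
    (DerivedCategory.singleFunctor C 0).obj Y ⟶ DerivedCategory.Q.obj (singleCone f) :=
  (DerivedCategory.Q.mapTriangle.obj
    (CochainComplex.mappingCone.triangle ((CochainComplex.singleFunctor C 0).map f))).mor₂

/-- The connecting morphism of the cone of `f : X ⟶ Y` in the derived category. -/
noncomputable def coneDelta : DerivedCategory.Q.obj (singleCone f) ⟶
    ((DerivedCategory.singleFunctor C 0).obj X)⟦(1 : ℤ)⟧ :=
  (DerivedCategory.Q.mapTriangle.obj
    (CochainComplex.mappingCone.triangle ((CochainComplex.singleFunctor C 0).map f))).mor₃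

lemma coneTriangle_distinguished :
    Triangle.mk ((DerivedCategory.singleFunctor C 0).map f) (coneInr f) (coneDelta f) ∈
      distTriang (DerivedCategory C) :=
  DerivedCategory.mappingCone_triangle_distinguished _

lemma map_comp_coneInr : (DerivedCategory.singleFunctor C 0).map f ≫ coneInr f = 0 :=
  comp_distTriang_mor_zero₁₂ _ (coneTriangle_distinguished f)

lemma coneDelta_comp_shift_map :
    coneDelta f ≫ ((DerivedCategory.singleFunctor C 0).map f)⟦(1 : ℤ)⟧' = 0 :=
  comp_distTriang_mor_zero₃₁ _ (coneTriangle_distinguished f)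

variable {f} {W : DerivedCategory C}

lemma exists_eq_coneInr_comp (φ : (DerivedCategory.singleFunctor C 0).obj Y ⟶ W)
    (h : (DerivedCategory.singleFunctor C 0).map f ≫ φ = 0) : ∃ g, φ = coneInr f ≫ g :=
  Triangle.yoneda_exact₂ _ (coneTriangle_distinguished f) φ h

lemma exists_eq_coneDelta_comp (φ : DerivedCategory.Q.obj (singleCone f) ⟶ W)
    (h : coneInr f ≫ φ = 0) : ∃ g, φ = coneDelta f ≫ g :=
  Triangle.yoneda_exact₃ _ (coneTriangle_distinguished f) φ h

lemma exists_eq_shift_map_comp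
    (φ : ((DerivedCategory.singleFunctor C 0).obj X)⟦(1 : ℤ)⟧ ⟶ W) (h : coneDelta f ≫ φ = 0) :
    ∃ g, φ = (-((DerivedCategory.singleFunctor C 0).map f)⟦(1 : ℤ)⟧') ≫ g :=
  Triangle.yoneda_exact₃ _ (rot_of_distTriang _ (coneTriangle_distinguished f)) φ h

variable (f) (Z : C)

/-- The connecting map from `Hom(X, Z)` to the shifted morphisms of degree `1` from the cone. -/
noncomputable def coneConnecting : (X ⟶ Z) →+
    (DerivedCategory.Q.obj (singleCone f) ⟶
      ((DerivedCategory.singleFunctor C 0).obj Z)⟦(1 : ℤ)⟧) where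
  toFun g := coneDelta f ≫ ((DerivedCategory.singleFunctor C 0).map g)⟦(1 : ℤ)⟧'
  map_zero' := by
    rw [Functor.map_zero, Functor.map_zero, Limits.comp_zero]
  map_add' g h := by
    rw [Functor.map_add, Functor.map_add, Preadditive.comp_add]

/-- The restriction to `Y` of the shifted morphisms of degree `0` from the cone. -/
noncomputable def coneRestrict :
    (DerivedCategory.Q.obj (singleCone f) ⟶
      ((DerivedCategory.singleFunctor C 0).obj Z)⟦(0 : ℤ)⟧) →+ (Y ⟶ Z) where
  toFun φ := (DerivedCategory.singleFunctor C 0).preimage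
    (coneInr f ≫ φ ≫ (shiftFunctorZero (DerivedCategory C) ℤ).hom.app _)
  map_zero' := by
    apply (DerivedCategory.singleFunctor C 0).map_injective
    rw [Functor.map_preimage, Functor.map_zero, Limits.zero_comp, Limits.comp_zero]
  map_add' φ ψ := by
    apply (DerivedCategory.singleFunctor C 0).map_injective
    rw [Functor.map_preimage, Functor.map_add, Functor.map_preimage, Functor.map_preimage,
      Preadditive.add_comp, Preadditive.comp_add]

variable {Z}

lemma map_coneRestrict (φ : DerivedCategory.Q.obj (singleCone f) ⟶
      ((DerivedCategory.singleFunctor C 0).obj Z)⟦(0 : ℤ)⟧) :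
    (DerivedCategory.singleFunctor C 0).map (coneRestrict f Z φ) =
      coneInr f ≫ φ ≫ (shiftFunctorZero (DerivedCategory C) ℤ).hom.app _ :=
  Functor.map_preimage _ _

/-- Undoing one shift turns this group into Ext^{k−1}(X, Z). -/
lemma shift_single_hom_eq_zero [Projective X] {k : ℤ} (hk : k ≠ 1)
    (φ : ((DerivedCategory.singleFunctor C 0).obj X)⟦(1 : ℤ)⟧ ⟶
      ((DerivedCategory.singleFunctor C 0).obj Z)⟦k⟧) : φ = 0 := by
  rw [← cancel_mono ((shiftFunctorAdd' (DerivedCategory C) (k - 1) 1 k (by lia)).hom.app _),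
    Limits.zero_comp]
  obtain ⟨ψ, hψ⟩ := (shiftFunctor (DerivedCategory C) (1 : ℤ)).map_surjective
    (φ ≫ (shiftFunctorAdd' (DerivedCategory C) (k - 1) 1 k (by lia)).hom.app _)
  rw [← hψ, shiftedHom_eq_zero_of_projective (by lia) ψ, Functor.map_zero]

lemma cone_shiftedHom_eq_zero [Projective X] [Projective Y] {k : ℤ} (h0 : k ≠ 0) (h1 : k ≠ 1)
    (φ : DerivedCategory.Q.obj (singleCone f) ⟶
      ((DerivedCategory.singleFunctor C 0).obj Z)⟦k⟧) : φ = 0 := by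
  obtain ⟨g, rfl⟩ := exists_eq_coneDelta_comp φ (shiftedHom_eq_zero_of_projective h0 _)
  rw [shift_single_hom_eq_zero h1 g, Limits.comp_zero]

/-- The kernel comes from Hom(X[1], Z) = Ext^{−1}(X, Z) = 0. -/
lemma coneRestrict_injective [Projective X] : Function.Injective (coneRestrict f Z) := by
  rw [injective_iff_map_eq_zero]
  intro φ hφ
  have h := map_coneRestrict f φ
  rw [hφ, Functor.map_zero, ← Category.assoc] at h
  obtain ⟨g, rfl⟩ := exists_eq_coneDelta_comp φ (by
    rw [← cancel_mono ((shiftFunctorZero (DerivedCategory C) ℤ).hom.app _), ← h,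
      Limits.zero_comp])
  rw [shift_single_hom_eq_zero zero_ne_one g, Limits.comp_zero]

lemma exists_coneRestrict_eq_iff (h : Y ⟶ Z) : (∃ φ, coneRestrict f Z φ = h) ↔ f ≫ h = 0 := by
  constructor
  · rintro ⟨φ, rfl⟩
    apply (DerivedCategory.singleFunctor C 0).map_injective
    rw [Functor.map_comp, map_coneRestrict, Functor.map_zero, ← Category.assoc,
      map_comp_coneInr, Limits.zero_comp]
  · intro hfh
    obtain ⟨g, hg⟩ := exists_eq_coneInr_comp (f := f)
      ((DerivedCategory.singleFunctor C 0).map h)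
      (by rw [← Functor.map_comp, hfh, Functor.map_zero])
    refine ⟨g ≫ (shiftFunctorZero (DerivedCategory C) ℤ).inv.app
      ((DerivedCategory.singleFunctor C 0).obj Z), ?_⟩
    apply (DerivedCategory.singleFunctor C 0).map_injective
    rw [map_coneRestrict, hg, Category.assoc, Iso.inv_hom_id_app]
    exact congrArg _ (Category.comp_id g)

/-- The obstruction is the restriction to Y, an element of Ext¹(Y, Z) = 0; full faithfulness then
brings the factor back to a morphism X ⟶ Z. -/
lemma coneConnecting_surjective [Projective Y] : Function.Surjective (coneConnecting f Z) := by
  intro φ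
  obtain ⟨g, rfl⟩ := exists_eq_coneDelta_comp φ (shiftedHom_eq_zero_of_projective one_ne_zero _)
  obtain ⟨g', rfl⟩ := (shiftFunctor (DerivedCategory C) (1 : ℤ)).map_surjective g
  obtain ⟨g'', rfl⟩ := (DerivedCategory.singleFunctor C 0).map_surjective g'
  exact ⟨g'', rfl⟩

lemma coneConnecting_eq_zero_iff (g : X ⟶ Z) :
    coneConnecting f Z g = 0 ↔ ∃ h : Y ⟶ Z, f ≫ h = g := by
  constructor
  · intro hg
    obtain ⟨h, hh⟩ := exists_eq_shift_map_comp (f := f)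
      (((DerivedCategory.singleFunctor C 0).map g)⟦(1 : ℤ)⟧') hg
    obtain ⟨h', rfl⟩ := (shiftFunctor (DerivedCategory C) (1 : ℤ)).map_surjective h
    obtain ⟨h'', rfl⟩ := (DerivedCategory.singleFunctor C 0).map_surjective h'
    -- The sign undoes the one introduced by rotating the triangle.
    refine ⟨-h'', ?_⟩
    apply (DerivedCategory.singleFunctor C 0).map_injective
    apply (shiftFunctor (DerivedCategory C) (1 : ℤ)).map_injective
    refine Eq.trans ?_ hh.symm
    rw [Functor.map_comp, Functor.map_comp, Functor.map_neg, Functor.map_neg,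
      Preadditive.comp_neg, Preadditive.neg_comp]
  · rintro ⟨h, rfl⟩
    change coneDelta f ≫ _ = 0
    rw [Functor.map_comp, Functor.map_comp, ← Category.assoc, coneDelta_comp_shift_map,
      Limits.zero_comp]

end Cone

/-- Morphisms to `ℤ` in the category of abelian groups as linear maps. -/
noncomputable def homULiftIntEquiv (M : Type u) [AddCommGroup M] [Module ℤ M] :
    (ModuleCat.of ℤ M ⟶ ModuleCat.of ℤ (ULift.{u} ℤ)) ≃+ (M →ₗ[ℤ] ℤ) where
  toFun g := (ULift.moduleEquiv : ULift.{u} ℤ ≃ₗ[ℤ] ℤ).toLinearMap ∘ₗ g.hom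
  invFun c := ModuleCat.ofHom ((ULift.moduleEquiv : ULift.{u} ℤ ≃ₗ[ℤ] ℤ).symm.toLinearMap ∘ₗ c)
  left_inv _ := rfl
  right_inv _ := rfl
  map_add' _ _ := rfl

/-! ### Cohomology of the derived dual of the divisor complex -/

variable {α : Type u} {β : Type v} {G : Graph α β} [Fintype V(G)] [Fintype E(G)]
  [HasDerivedCategory.{w} (ModuleCat.{u} ℤ)]

lemma subsingleton_derivedDualCohomology (o : Orientation G) {k : ℤ} (h0 : k ≠ 0) (h1 : k ≠ 1) :
    Subsingleton (derivedDualCohomology.{w} (divisorComplex o) k) :=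
  subsingleton_of_forall_eq 0
    (cone_shiftedHom_eq_zero (ModuleCat.ofHom (prin o).subtype) h0 h1)

lemma nonempty_derivedDualCohomology_zero_equiv [G.Loopless] (hG : G.toSimpleGraph.Connected)
    (o : Orientation G) :
    Nonempty (derivedDualCohomology.{w} (divisorComplex o) 0 ≃ₗ[ℤ] ℤ) := by
  obtain ⟨q⟩ := hG.nonempty
  let R := LinearMap.ker (LinearMap.lcomp ℤ ℤ (prin o).subtype)
  let Φ : derivedDualCohomology.{w} (divisorComplex o) 0 →+ (Divisor G →ₗ[ℤ] ℤ) :=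
    (homULiftIntEquiv (Divisor G)).toAddMonoidHom.comp
      (coneRestrict (ModuleCat.ofHom (prin o).subtype) (ModuleCat.of ℤ (ULift.{u} ℤ)))
  have hinj : Function.Injective Φ :=
    (homULiftIntEquiv (Divisor G)).injective.comp (coneRestrict_injective _)
  have hmem : ∀ c, c ∈ R ↔ ∃ φ, Φ φ = c := by
    intro c
    have h := exists_coneRestrict_eq_iff (ModuleCat.ofHom (prin o).subtype)
      ((homULiftIntEquiv (Divisor G)).symm c)
    have h1 : c ∈ R ↔ ModuleCat.ofHom (prin o).subtype ≫
        (homULiftIntEquiv (Divisor G)).symm c = 0 := by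
      rw [← (homULiftIntEquiv (prin o)).map_eq_zero_iff]
      rfl
    rw [h1, ← h]
    exact exists_congr fun φ => (homULiftIntEquiv (Divisor G)).eq_symm_apply
  let Ψ : derivedDualCohomology.{w} (divisorComplex o) 0 →ₗ[ℤ] R :=
    LinearMap.codRestrict R Φ.toIntLinearMap fun φ => (hmem _).2 ⟨φ, rfl⟩
  exact ⟨(LinearEquiv.ofBijective Ψ ⟨fun a b h => hinj (congrArg Subtype.val h),
    fun c => by
      obtain ⟨φ, hφ⟩ := (hmem c).1 c.2
      exact ⟨φ, Subtype.ext hφ⟩⟩).trans (kerRestrictEquiv hG o q)⟩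

lemma nonempty_derivedDualCohomology_one_equiv [G.Loopless] (hG : G.toSimpleGraph.Connected)
    (o : Orientation G) :
    Nonempty (derivedDualCohomology.{w} (divisorComplex o) 1 ≃ₗ[ℤ]
      Submodule.torsion ℤ (Jac o)) := by
  let Φ : (prin o →ₗ[ℤ] ℤ) →+ derivedDualCohomology.{w} (divisorComplex o) 1 :=
    (coneConnecting (ModuleCat.ofHom (prin o).subtype) (ModuleCat.of ℤ (ULift.{u} ℤ))).comp
      (homULiftIntEquiv (prin o)).symm.toAddMonoidHom
  have hsurj : Function.Surjective Φ.toIntLinearMap :=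
    (coneConnecting_surjective _).comp (homULiftIntEquiv (prin o)).symm.surjective
  have hker : LinearMap.ker Φ.toIntLinearMap = LinearMap.ker (dualPrinToJac o) := by
    rw [ker_dualPrinToJac]
    ext c
    refine (coneConnecting_eq_zero_iff _ ((homULiftIntEquiv (prin o)).symm c)).trans ?_
    constructor
    · rintro ⟨h, hh⟩
      exact ⟨homULiftIntEquiv _ h, (homULiftIntEquiv (prin o)).eq_symm_apply.1 hh⟩
    · rintro ⟨d, rfl⟩
      exact ⟨(homULiftIntEquiv _).symm d, rfl⟩
  exact ⟨(Φ.toIntLinearMap.quotKerEquivOfSurjective hsurj).symm.trans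
    ((Submodule.quotEquivOfEq _ _ hker).trans ((dualPrinToJac o).quotKerEquivRange.trans
      (LinearEquiv.ofEq _ _ (range_dualPrinToJac hG o))))⟩

lemma finite_derivedDualCohomology [G.Loopless] (hG : G.toSimpleGraph.Connected)
    (o : Orientation G) (k : ℤ) :
    Module.Finite ℤ (derivedDualCohomology.{w} (divisorComplex o) k) := by
  by_cases h0 : k = 0
  · subst h0
    obtain ⟨e⟩ := nonempty_derivedDualCohomology_zero_equiv hG o
    exact Module.Finite.equiv e.symm
  · by_cases h1 : k = 1
    · subst h1
      obtain ⟨e⟩ := nonempty_derivedDualCohomology_one_equiv hG o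
      exact Module.Finite.equiv e.symm
    · have := subsingleton_derivedDualCohomology o h0 h1
      infer_instance

lemma derivedDualEulerChar_divisorComplex [G.Loopless] (hG : G.toSimpleGraph.Connected)
    (o : Orientation G) : derivedDualEulerChar.{w} (divisorComplex o) = 1 := by
  obtain ⟨e₀⟩ := nonempty_derivedDualCohomology_zero_equiv.{w} hG o
  obtain ⟨e₁⟩ := nonempty_derivedDualCohomology_one_equiv.{w} hG o
  have h0 : Module.finrank ℤ (derivedDualCohomology.{w} (divisorComplex o) 0) = 1 := by
    rw [e₀.finrank_eq, Module.finrank_self]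
  have h1 : Module.finrank ℤ (derivedDualCohomology.{w} (divisorComplex o) 1) = 0 := by
    rw [e₁.finrank_eq]
    exact Module.finrank_eq_zero_iff_isTorsion.2 (Submodule.torsion_isTorsion)
  rw [derivedDualEulerChar,
    -- Degree 1 drops out of the rank support because H¹ is torsion.
    GradedObject.eulerChar_eq_sum_finSet_of_finrankSupport_subset _ _ {0}]
  · rw [Finset.sum_singleton, h0]
    rfl
  · rw [GradedObject.finrankSupport_subset_iff]
    intro k hk
    by_cases hk1 : k = 1
    · rw [hk1, h1]
    · have := subsingleton_derivedDualCohomology.{w} o (by simpa using hk) hk1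
      exact Module.finrank_zero_of_subsingleton

end DerivedDual

end GraphRR

theorem mainTheorem5 {α : Type u} {β : Type v} (G : Graph α β) [Fintype V(G)] [Fintype E(G)]
    [G.Loopless] (hG : G.toSimpleGraph.Connected) (o : GraphRR.Orientation G)
    [HasDerivedCategory.{w} (ModuleCat.{u} ℤ)] :
    (∀ D : GraphRR.Divisor G,
      -- the ranks are genuine maxima
      IsGreatest (GraphRR.rankSet o D) (GraphRR.rank o D) ∧
      -- the Riemann–Roch formula
      GraphRR.rank o D - GraphRR.rank o (GraphRR.canonicalDivisor G - D)
        = GraphRR.deg D + 1 - GraphRR.genus G ∧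
      -- its form through the Euler characteristic of `C₁(G) → C₀(G)`
      GraphRR.rank o D - GraphRR.rank o (GraphRR.canonicalDivisor G - D)
        = GraphRR.deg D + GraphRR.masterEulerChar o ∧
      -- its form through the Euler characteristic of the derived dual of the divisor complex
      GraphRR.rank o D - GraphRR.rank o (GraphRR.canonicalDivisor G - D)
        = GraphRR.derivedDualEulerChar.{w} (GraphRR.divisorComplex o)
          + GraphRR.deg D - GraphRR.genus G) ∧
    -- the cohomology of the derived dual is finitely generated, sits in degrees `0` and `1`,
    -- has Euler characteristic `1`, and its `H¹` is the torsion of the Jacobian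
    (∀ k : ℤ, Module.Finite ℤ
      (GraphRR.derivedDualCohomology.{w} (GraphRR.divisorComplex o) k)) ∧
    (∀ k : ℤ, k ≠ 0 → k ≠ 1 → Subsingleton
      (GraphRR.derivedDualCohomology.{w} (GraphRR.divisorComplex o) k)) ∧
    GraphRR.derivedDualEulerChar.{w} (GraphRR.divisorComplex o) = 1 ∧
    Nonempty (GraphRR.derivedDualCohomology.{w} (GraphRR.divisorComplex o) 1
      ≃ₗ[ℤ] Submodule.torsion ℤ (GraphRR.Jac o)) := by
  have hRR := GraphRR.rank_sub_rank_canonicalDivisor_sub hG o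
  have hchi := GraphRR.derivedDualEulerChar_divisorComplex.{w} hG o
  have := hG.nonempty
  refine ⟨fun D => ⟨GraphRR.isGreatest_rank o D, hRR D, ?_, ?_⟩,
    GraphRR.finite_derivedDualCohomology hG o,
    fun k => GraphRR.subsingleton_derivedDualCohomology o, hchi,
    GraphRR.nonempty_derivedDualCohomology_one_equiv hG o⟩
  · rw [hRR, GraphRR.masterEulerChar_eq]
    ring
  · rw [hRR, hchi]
    ring
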